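/- Let $d\ge 1$, let $(\mathcal Z,\nu)$ be a probability space, and let $z\mapsto\rho(\cdot|z)$ be a Markov kernel from $\mathcal Z$ to $\mathbb R^d$ such that the mixture $\rho=\int_{\mathcal Z}\rho(\cdot|z)\,d\nu(z)$ has finite second moment. Let $\mathcal P_2(\mathbb R^d)$ be the set of Borel probability measures on $\mathbb R^d$ with finite second moment and $$W_2^2(\rho_1,\rho_2)=\inf_{X\sim\rho_1,\,Y\sim\rho_2}\mathbb E\|X-Y\|^2 ,$$ the infimum being over all couplings. A (Wasserstein) barycenter of $\rho(\cdot|z)\,\nu$ is a minimizer $\mu\in\mathcal P_2(\mathbb R^d)$ of $$\mu\mapsto\int_{\mathcal Z} W_2^2\big(\rho(\cdot|z),\mu\big)\,d\nu(z).$$ Suppose that there are functions $\bar x:\mathcal Z\to\mathbb R^d$ and $\sigma:\mathcal Z\to\mathbb R$ such that, for $\nu$-almost every $z$, $\sigma(z)\ge 0$ and $\rho(\cdot|z)=\mathcal N(\bar x(z),\sigma^2(z)I_d)$ is an isotropic Gaussian (a Dirac mass if $\sigma(z)=0$). Then $\bar x$ and $\sigma$ are $\nu$-integrable, the barycenter exists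 and is unique, and it is the isotropic Gaussian $\mathcal N(\bar y,\sigma_y^2 I_d)$ with mean and standard deviation $$\bar y=\int_{\mathcal Z}\bar x(z)\,d\nu(z)=\mathbb E_{X\sim\rho}[X],\qquad \sigma_y=\int_{\mathcal Z}\sigma(z)\,d\nu(z).$$ -/

import Mathlib

open MeasureTheory ProbabilityTheory
open scoped ENNReal

/-- `μ` is a Borel probability measure on `ℝ^d` with finite second moment. -/
def IsP2 {d : ℕ} (μ : Measure (EuclideanSpace ℝ (Fin d))) : Prop :=
  IsProbabilityMeasure μ ∧ ∫⁻ x, ‖x‖ₑ ^ 2 ∂μ < ∞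

/-- `γ` is a coupling of `ρ` and `μ`: the joint law of some `(X, Y)` with `X ∼ ρ`, `Y ∼ μ`. -/
def IsCoupling {d : ℕ} (ρ μ : Measure (EuclideanSpace ℝ (Fin d)))
    (γ : Measure (EuclideanSpace ℝ (Fin d) × EuclideanSpace ℝ (Fin d))) : Prop :=
  γ.map Prod.fst = ρ ∧ γ.map Prod.snd = μ

/-- The squared 2-Wasserstein distance `W₂²(ρ, μ)`: the infimum of `𝔼 ‖X - Y‖²` over all couplings
of `ρ` and `μ`. -/
noncomputable def wassersteinSq {d : ℕ} (ρ μ : Measure (EuclideanSpace ℝ (Fin d))) : ℝ≥0∞ :=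
  ⨅ (γ : Measure (EuclideanSpace ℝ (Fin d) × EuclideanSpace ℝ (Fin d))) (_ : IsCoupling ρ μ γ),
    ∫⁻ p, ‖p.1 - p.2‖ₑ ^ 2 ∂γ

/-- The average transport cost `∫ W₂²(ρ(·|z), μ) dν(z)`, where `κ z = ρ(·|z)`. -/
noncomputable def transportCost {Z : Type*} [MeasurableSpace Z] {d : ℕ} (ν : Measure Z)
    (κ : Kernel Z (EuclideanSpace ℝ (Fin d))) (μ : Measure (EuclideanSpace ℝ (Fin d))) : ℝ≥0∞ :=
  ∫⁻ z, wassersteinSq (κ z) μ ∂ν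

/-- `μ` is a Wasserstein barycenter of the conditionals `κ z = ρ(·|z)` weighted by `ν`: it minimizes
the average transport cost over all probability measures with finite second moment. -/
def IsBarycenter {Z : Type*} [MeasurableSpace Z] {d : ℕ} (ν : Measure Z)
    (κ : Kernel Z (EuclideanSpace ℝ (Fin d))) (μ : Measure (EuclideanSpace ℝ (Fin d))) : Prop :=
  IsP2 μ ∧ ∀ μ' : Measure (EuclideanSpace ℝ (Fin d)),
    IsP2 μ' → transportCost ν κ μ ≤ transportCost ν κ μ'

/-- The isotropic Gaussian `N(m, s² I_d)` on `ℝ^d` (the Dirac mass at `m` if `s = 0`). -/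
noncomputable def isotropicGaussian {d : ℕ} (m : EuclideanSpace ℝ (Fin d)) (s : ℝ) :
    Measure (EuclideanSpace ℝ (Fin d)) :=
  multivariateGaussian m (s ^ 2 • (1 : Matrix (Fin d) (Fin d) ℝ))

/-!
The average cost `μ ↦ ∫ W₂²(κ z, μ) dν(z)` equals, up to an additive constant, the single squared
distance `W₂²(μ⋆, μ)` to `μ⋆ = N(ȳ, σ_y² I)`. Existence and uniqueness of the minimizer are then
immediate, and no duality, no optimal coupling and no compactness argument is needed.

To see this, expand the square: for a coupling `(G, Y)` of `N(0, I)` and `μ` and `s ≥ 0`,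
`𝔼 ‖m + s G - Y‖² = ‖m‖² + d s² + 𝔼 ‖Y‖² - 2 ⟪m, 𝔼 Y⟫ - s (d + 𝔼 ‖Y‖² - 𝔼 ‖G - Y‖²)`.
Every coupling of `N(m, s² I)` and `μ` arises in this way
(`IsCoupling.exists_map_stdGaussian`), and the right-hand side is nondecreasing in `𝔼 ‖G - Y‖²`, so
taking infima gives the same formula for `W₂²(N(m, s² I), μ)` in terms of `W₂²(N(0, I), μ)`
(`toReal_wassersteinSq_isotropicGaussian`). Apart from `‖m‖² + d s²`, which does not involve `μ`,
it is affine in `(m, s)`. Averaging over `z` therefore replaces `(xbar z, σ z)` by the means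
`(ȳ, σ_y)`, up to a constant (`exists_transportCost_eq_add`).

Uniqueness needs that `W₂² = 0` forces equality (`eq_of_wassersteinSq_eq_zero`); this follows by
comparing characteristic functions along almost optimal couplings. Integrability of the parameters
comes from reading off the first two moments of `κ z` (`memLp_parameters`).
-/

open scoped RealInnerProductSpace

/-! ### Isotropic Gaussians -/

section Gaussian

variable {d : ℕ}

lemma isotropicGaussian_eq_map_stdGaussian (m : EuclideanSpace ℝ (Fin d)) {s : ℝ} (hs : 0 ≤ s) :
    isotropicGaussian m s =
      (stdGaussian (EuclideanSpace ℝ (Fin d))).map (fun g ↦ m + s • g) := by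
  open scoped MatrixOrder in
  have hsqrt : CFC.sqrt (s ^ 2 • (1 : Matrix (Fin d) (Fin d) ℝ)) = s • 1 := by
    refine CFC.sqrt_unique (by simp [smul_smul, pow_two]) ?_
    exact Matrix.nonneg_iff_posSemidef.2 (Matrix.PosSemidef.one.smul hs)
  rw [isotropicGaussian, multivariateGaussian, hsqrt]
  simp

instance isGaussian_isotropicGaussian (m : EuclideanSpace ℝ (Fin d)) (s : ℝ) :
    IsGaussian (isotropicGaussian m s) := by
  unfold isotropicGaussian; infer_instance

lemma integral_norm_sq_stdGaussian :
    ∫ g, ‖g‖ ^ 2 ∂(stdGaussian (EuclideanSpace ℝ (Fin d))) = d := by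
  have hL2 (i : Fin d) :
      MemLp (fun g : EuclideanSpace ℝ (Fin d) ↦ g i) 2 (stdGaussian _) :=
    IsGaussian.memLp_dual _ (EuclideanSpace.proj i) 2 (by simp)
  have hcoord (i : Fin d) :
      ∫ g, g i ^ 2 ∂(stdGaussian (EuclideanSpace ℝ (Fin d))) = 1 := by
    have hvar := variance_eval_multivariateGaussian (μ := (0 : EuclideanSpace ℝ (Fin d)))
      (Matrix.PosSemidef.one (n := Fin d) (R := ℝ)) i
    rw [multivariateGaussian_zero_one, variance_eq_sub (hL2 i)] at hvar
    have hmean : ∫ g, g i ∂(stdGaussian (EuclideanSpace ℝ (Fin d))) = 0 :=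
      integral_strongDual_stdGaussian (EuclideanSpace.proj i : StrongDual ℝ _)
    simpa [hmean] using hvar
  simp_rw [EuclideanSpace.real_norm_sq_eq]
  rw [integral_finsetSum _ fun i _ ↦ (hL2 i).integrable_sq]
  simp [hcoord]

lemma integral_isotropicGaussian (m : EuclideanSpace ℝ (Fin d)) (s : ℝ) :
    ∫ x, x ∂(isotropicGaussian m s) = m := by
  simp [isotropicGaussian]

lemma integral_norm_sq_isotropicGaussian (m : EuclideanSpace ℝ (Fin d)) {s : ℝ} (hs : 0 ≤ s) :
    ∫ x, ‖x‖ ^ 2 ∂(isotropicGaussian m s) = ‖m‖ ^ 2 + d * s ^ 2 := by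
  have hid : Integrable (fun g ↦ g) (stdGaussian (EuclideanSpace ℝ (Fin d))) :=
    IsGaussian.integrable_id
  have hsq : Integrable (fun g ↦ ‖g‖ ^ 2) (stdGaussian (EuclideanSpace ℝ (Fin d))) :=
    IsGaussian.memLp_two_id.integrable_norm_pow (by norm_num)
  have hin : Integrable (fun g ↦ ⟪m, g⟫) (stdGaussian (EuclideanSpace ℝ (Fin d))) :=
    hid.const_inner m
  rw [isotropicGaussian_eq_map_stdGaussian m hs, integral_map (by fun_prop) (by fun_prop)]
  have hexp (g : EuclideanSpace ℝ (Fin d)) :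
      ‖m + s • g‖ ^ 2 = ‖m‖ ^ 2 + 2 * s * ⟪m, g⟫ + s ^ 2 * ‖g‖ ^ 2 := by
    rw [norm_add_sq_real, real_inner_smul_right, norm_smul, mul_pow, Real.norm_eq_abs, sq_abs]
    ring
  simp_rw [hexp]
  rw [integral_add (by fun_prop) (by fun_prop), integral_add (by fun_prop) (by fun_prop),
    integral_const_mul, integral_const_mul, integral_norm_sq_stdGaussian, integral_inner hid]
  simp
  ring

end Gaussian

/-! ### Couplings of measures with finite second moment -/

section Coupling

variable {d : ℕ} {ρ μ : Measure (EuclideanSpace ℝ (Fin d))}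
  {γ : Measure (EuclideanSpace ℝ (Fin d) × EuclideanSpace ℝ (Fin d))}

lemma IsP2.memLp (hμ : IsP2 μ) : MemLp (fun x ↦ x) 2 μ := by
  refine ⟨by fun_prop, ?_⟩
  rw [eLpNorm_lt_top_iff_lintegral_rpow_enorm_lt_top (by norm_num) (by norm_num)]
  simpa using hμ.2

lemma isP2_of_memLp [IsProbabilityMeasure μ] (hμ : MemLp (fun x ↦ x) 2 μ) : IsP2 μ := by
  refine ⟨inferInstance, ?_⟩
  have := hμ.2
  rw [eLpNorm_lt_top_iff_lintegral_rpow_enorm_lt_top (by norm_num) (by norm_num)] at this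
  simpa using this

lemma IsP2.of_isGaussian [IsGaussian μ] : IsP2 μ :=
  isP2_of_memLp IsGaussian.memLp_two_id

lemma IsCoupling.isProbabilityMeasure [IsProbabilityMeasure ρ] (h : IsCoupling ρ μ γ) :
    IsProbabilityMeasure γ := by
  have : IsProbabilityMeasure (γ.map Prod.fst) := by rw [h.1]; infer_instance
  exact Measure.isProbabilityMeasure_of_map Prod.fst

lemma isCoupling_prod [IsProbabilityMeasure ρ] [IsProbabilityMeasure μ] :
    IsCoupling ρ μ (ρ.prod μ) := by
  constructor <;> simp [Measure.map_fst_prod, Measure.map_snd_prod]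

lemma IsCoupling.memLp_fst (h : IsCoupling ρ μ γ) (hρ : IsP2 ρ) :
    MemLp (fun p ↦ p.1) 2 γ := by
  have := hρ.memLp
  rw [← h.1] at this
  exact (memLp_map_measure_iff (f := Prod.fst) (g := fun x ↦ x) (by fun_prop) (by fun_prop)).1 this

lemma IsCoupling.memLp_snd (h : IsCoupling ρ μ γ) (hμ : IsP2 μ) :
    MemLp (fun p ↦ p.2) 2 γ := by
  have := hμ.memLp
  rw [← h.2] at this
  exact (memLp_map_measure_iff (f := Prod.snd) (g := fun x ↦ x) (by fun_prop) (by fun_prop)).1 this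

lemma IsCoupling.integrable_norm_sub_sq (h : IsCoupling ρ μ γ) (hρ : IsP2 ρ) (hμ : IsP2 μ) :
    Integrable (fun p ↦ ‖p.1 - p.2‖ ^ 2) γ :=
  ((h.memLp_fst hρ).sub (h.memLp_snd hμ)).integrable_norm_pow (by norm_num)

lemma IsCoupling.lintegral_enorm_sub_sq (h : IsCoupling ρ μ γ) (hρ : IsP2 ρ) (hμ : IsP2 μ) :
    ∫⁻ p, ‖p.1 - p.2‖ₑ ^ 2 ∂γ = ENNReal.ofReal (∫ p, ‖p.1 - p.2‖ ^ 2 ∂γ) := by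
  rw [ofReal_integral_eq_lintegral_ofReal (h.integrable_norm_sub_sq hρ hμ)
    (ae_of_all _ fun _ ↦ by positivity)]
  simp_rw [ENNReal.ofReal_pow (norm_nonneg _), ofReal_norm]

/-- The set of real transport costs `𝔼 ‖X - Y‖²` of the couplings of `ρ` and `μ`. -/
def couplingCosts (ρ μ : Measure (EuclideanSpace ℝ (Fin d))) : Set ℝ :=
  {c | ∃ γ, IsCoupling ρ μ γ ∧ ∫ p, ‖p.1 - p.2‖ ^ 2 ∂γ = c}

lemma couplingCosts_nonempty (hρ : IsP2 ρ) (hμ : IsP2 μ) : (couplingCosts ρ μ).Nonempty :=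
  have := hρ.1
  have := hμ.1
  ⟨_, ρ.prod μ, isCoupling_prod, rfl⟩

lemma wassersteinSq_lt_top (hρ : IsP2 ρ) (hμ : IsP2 μ) : wassersteinSq ρ μ < ∞ := by
  have := hρ.1
  have := hμ.1
  refine (iInf₂_le _ isCoupling_prod).trans_lt ?_
  rw [isCoupling_prod.lintegral_enorm_sub_sq hρ hμ]
  exact ENNReal.ofReal_lt_top

lemma isGLB_couplingCosts (hρ : IsP2 ρ) (hμ : IsP2 μ) :
    IsGLB (couplingCosts ρ μ) (wassersteinSq ρ μ).toReal := by
  constructor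
  · rintro _ ⟨γ, hγ, rfl⟩
    refine ENNReal.toReal_le_of_le_ofReal (integral_nonneg fun _ ↦ by positivity) ?_
    rw [← hγ.lintegral_enorm_sub_sq hρ hμ]
    exact iInf₂_le _ hγ
  · intro b hb
    rw [← ENNReal.ofReal_le_iff_le_toReal (wassersteinSq_lt_top hρ hμ).ne]
    refine le_iInf₂ fun γ hγ ↦ ?_
    rw [hγ.lintegral_enorm_sub_sq hρ hμ]
    exact ENNReal.ofReal_le_ofReal (hb ⟨γ, hγ, rfl⟩)

lemma wassersteinSq_self (μ : Measure (EuclideanSpace ℝ (Fin d))) : wassersteinSq μ μ = 0 := by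
  have hdiag : Measurable fun x : EuclideanSpace ℝ (Fin d) ↦ (x, x) := by fun_prop
  have hγ : IsCoupling μ μ (μ.map fun x ↦ (x, x)) := by
    constructor <;> rw [Measure.map_map (by fun_prop) hdiag] <;> exact Measure.map_id
  refine le_antisymm ((iInf₂_le _ hγ).trans_eq ?_) zero_le
  rw [lintegral_map (by fun_prop) hdiag]
  simp

/-- Any coupling bounds the difference of the characteristic functions; `η` is the parameter of
`r ≤ η + r² / η`, which replaces an appeal to the Cauchy-Schwarz inequality. -/
lemma IsCoupling.norm_charFun_sub_le (h : IsCoupling ρ μ γ) (hρ : IsP2 ρ) (hμ : IsP2 μ)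
    (t : EuclideanSpace ℝ (Fin d)) {η : ℝ} (hη : 0 < η) :
    ‖charFun ρ t - charFun μ t‖ ≤ ‖t‖ * (η + (∫ p, ‖p.1 - p.2‖ ^ 2 ∂γ) / η) := by
  have := hρ.1
  have := h.isProbabilityMeasure
  have hint {f : EuclideanSpace ℝ (Fin d) × EuclideanSpace ℝ (Fin d) → EuclideanSpace ℝ (Fin d)}
      (hf : Measurable f) : Integrable (fun p ↦ Complex.exp (⟪f p, t⟫ * Complex.I)) γ := by
    refine (integrable_const (1 : ℝ)).mono' (by fun_prop) (ae_of_all _ fun p ↦ ?_)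
    rw [Complex.norm_exp_ofReal_mul_I]
  have hsq := h.integrable_norm_sub_sq hρ hμ
  have hexp (a b : ℝ) :
      ‖Complex.exp (a * Complex.I) - Complex.exp (b * Complex.I)‖ ≤ |a - b| := by
    have : Complex.exp (a * Complex.I) - Complex.exp (b * Complex.I) =
        Complex.exp (b * Complex.I) * (Complex.exp (Complex.I * (a - b : ℝ)) - 1) := by
      rw [mul_sub, ← Complex.exp_add]
      push_cast
      ring_nf
    rw [this, norm_mul, Complex.norm_exp_ofReal_mul_I, one_mul]
    exact Real.norm_exp_I_mul_ofReal_sub_one_le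
  rw [charFun_apply, charFun_apply]
  conv_lhs => rw [← h.1, ← h.2]
  rw [integral_map (by fun_prop) (by fun_prop), integral_map (by fun_prop) (by fun_prop),
    ← integral_sub (hint measurable_fst) (hint measurable_snd)]
  calc _ ≤ ∫ p, ‖t‖ * (η + ‖p.1 - p.2‖ ^ 2 / η) ∂γ := by
        refine norm_integral_le_of_norm_le (by fun_prop) (ae_of_all _ fun p ↦ ?_)
        have hη' : ‖p.1 - p.2‖ ≤ η + ‖p.1 - p.2‖ ^ 2 / η := by
          rw [← sub_le_iff_le_add', le_div_iff₀ hη]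
          nlinarith [sq_nonneg (‖p.1 - p.2‖ - η), norm_nonneg (p.1 - p.2)]
        calc _ ≤ |⟪p.1, t⟫ - ⟪p.2, t⟫| := hexp _ _
          _ = |⟪p.1 - p.2, t⟫| := by rw [inner_sub_left]
          _ ≤ ‖p.1 - p.2‖ * ‖t‖ := abs_real_inner_le_norm _ _
          _ ≤ _ := by rw [mul_comm]; gcongr
    _ = _ := by
        rw [integral_const_mul, integral_add (by fun_prop) (by fun_prop), integral_div]
        simp

lemma eq_of_wassersteinSq_eq_zero (hρ : IsP2 ρ) (hμ : IsP2 μ) (h : wassersteinSq ρ μ = 0) :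
    ρ = μ := by
  have := hρ.1
  have := hμ.1
  refine Measure.ext_of_charFun (funext fun t ↦ sub_eq_zero.1 (norm_le_zero_iff.1 ?_))
  refine le_of_forall_pos_le_add fun ε hε ↦ ?_
  -- With `η` this value and a coupling of cost below `η²`, the bound is at most `2 ‖t‖ η ≤ ε`.
  have hη : 0 < ε / (2 * (‖t‖ + 1)) := by positivity
  obtain ⟨_, ⟨γ, hγ, rfl⟩, -, hc⟩ := (isGLB_couplingCosts hρ hμ).exists_between
    (b := (ε / (2 * (‖t‖ + 1))) ^ 2) (by rw [h]; simpa using by positivity)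
  set η := ε / (2 * (‖t‖ + 1)) with hηdef
  refine (hγ.norm_charFun_sub_le hρ hμ t hη).trans ?_
  have h1 : (∫ p, ‖p.1 - p.2‖ ^ 2 ∂γ) / η ≤ η := by
    rw [div_le_iff₀ hη]; nlinarith
  have h2 : (‖t‖ + 1) * (2 * η) = ε := by rw [hηdef]; field_simp
  nlinarith [norm_nonneg t]

end Coupling

/-! ### The distance from an isotropic Gaussian to an arbitrary measure -/

section GaussianTransport

variable {d : ℕ} {μ : Measure (EuclideanSpace ℝ (Fin d))}
  {γ : Measure (EuclideanSpace ℝ (Fin d) × EuclideanSpace ℝ (Fin d))}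

lemma IsCoupling.map_stdGaussian (h : IsCoupling (stdGaussian _) μ γ)
    (m : EuclideanSpace ℝ (Fin d)) {s : ℝ} (hs : 0 ≤ s) :
    IsCoupling (isotropicGaussian m s) μ (γ.map fun p ↦ (m + s • p.1, p.2)) := by
  constructor
  · rw [isotropicGaussian_eq_map_stdGaussian m hs, ← h.1,
      Measure.map_map (by fun_prop) (by fun_prop), Measure.map_map (by fun_prop) (by fun_prop)]
    rfl
  · rw [Measure.map_map (by fun_prop) (by fun_prop)]
    exact h.2

/-- Every coupling with `N(m, s² I)` arises from a coupling with `N(0, I)` by rescaling the first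
variable. For `s > 0` the rescaling is invertible; for `s = 0` the first variable is constant and
the product coupling does. -/
lemma IsCoupling.exists_map_stdGaussian [IsProbabilityMeasure μ] {m : EuclideanSpace ℝ (Fin d)}
    {s : ℝ} (hs : 0 ≤ s) (h : IsCoupling (isotropicGaussian m s) μ γ) :
    ∃ γ', IsCoupling (stdGaussian _) μ γ' ∧ γ'.map (fun p ↦ (m + s • p.1, p.2)) = γ := by
  rcases hs.eq_or_lt with rfl | hs'
  · refine ⟨(stdGaussian _).prod μ, isCoupling_prod, ?_⟩
    have hdirac : γ.map Prod.fst = Measure.dirac m := by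
      rw [h.1, isotropicGaussian_eq_map_stdGaussian m le_rfl]
      simp
    have hfst : ∀ᵐ p ∂γ, p.1 = m := by
      refine ae_of_ae_map (f := Prod.fst) (p := fun x ↦ x = m) (by fun_prop) ?_
      rw [hdirac, ae_dirac_eq, Filter.eventually_pure]
    have hγ : γ = γ.map fun p ↦ (m, p.2) := by
      conv_lhs => rw [← Measure.map_id (μ := γ)]
      refine Measure.map_congr ?_
      filter_upwards [hfst] with p hp
      exact Prod.ext hp rfl
    have hmk : Measurable (Prod.mk m : EuclideanSpace ℝ (Fin d) → _ × EuclideanSpace ℝ (Fin d)) :=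
      measurable_prodMk_left
    have hfactor (γ₀ : Measure (EuclideanSpace ℝ (Fin d) × EuclideanSpace ℝ (Fin d))) :
        γ₀.map (fun p ↦ (m, p.2)) = (γ₀.map Prod.snd).map (Prod.mk m) := by
      rw [Measure.map_map hmk (by fun_prop)]
      rfl
    rw [hγ, hfactor, h.2]
    simp only [zero_smul, add_zero]
    rw [hfactor, (isCoupling_prod (ρ := stdGaussian (EuclideanSpace ℝ (Fin d)))).2]
  · refine ⟨γ.map (fun p ↦ (s⁻¹ • (p.1 - m), p.2)), ⟨?_, ?_⟩, ?_⟩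
    · rw [Measure.map_map (by fun_prop) (by fun_prop)]
      have : Prod.fst ∘ (fun p : EuclideanSpace ℝ (Fin d) × EuclideanSpace ℝ (Fin d) ↦
          (s⁻¹ • (p.1 - m), p.2)) = (fun x ↦ s⁻¹ • (x - m)) ∘ Prod.fst := rfl
      rw [this, ← Measure.map_map (by fun_prop) (by fun_prop), h.1,
        isotropicGaussian_eq_map_stdGaussian m hs, Measure.map_map (by fun_prop) (by fun_prop)]
      convert Measure.map_id using 2
      ext1 g
      simp [hs'.ne']
    · rw [Measure.map_map (by fun_prop) (by fun_prop)]
      exact h.2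
    · rw [Measure.map_map (by fun_prop) (by fun_prop)]
      convert Measure.map_id using 2
      ext1 p
      simp [hs'.ne']

lemma IsCoupling.integral_map_stdGaussian (h : IsCoupling (stdGaussian _) μ γ) (hμ : IsP2 μ)
    (m : EuclideanSpace ℝ (Fin d)) (s : ℝ) :
    ∫ p, ‖p.1 - p.2‖ ^ 2 ∂(γ.map fun p ↦ (m + s • p.1, p.2)) =
      ‖m‖ ^ 2 + d * s ^ 2 + ∫ y, ‖y‖ ^ 2 ∂μ - 2 * ⟪m, ∫ y, y ∂μ⟫
        - s * (d + ∫ y, ‖y‖ ^ 2 ∂μ - ∫ p, ‖p.1 - p.2‖ ^ 2 ∂γ) := by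
  have := h.isProbabilityMeasure
  have h1 := h.memLp_fst IsP2.of_isGaussian
  have h2 := h.memLp_snd hμ
  have i1 : Integrable (fun p ↦ ‖p.1‖ ^ 2) γ := h1.integrable_norm_pow (by norm_num)
  have i2 : Integrable (fun p ↦ ‖p.2‖ ^ 2) γ := h2.integrable_norm_pow (by norm_num)
  have i3 := h.integrable_norm_sub_sq IsP2.of_isGaussian hμ
  have j1 : Integrable (fun p ↦ p.1) γ := h1.integrable (by norm_num)
  have j2 : Integrable (fun p ↦ p.2) γ := h2.integrable (by norm_num)
  have k1 : Integrable (fun p ↦ ⟪m, p.1⟫) γ := j1.const_inner m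
  have k2 : Integrable (fun p ↦ ⟪m, p.2⟫) γ := j2.const_inner m
  have e1 : ∫ p, ‖p.1‖ ^ 2 ∂γ = d := by
    rw [← integral_norm_sq_stdGaussian, ← h.1, integral_map (by fun_prop) (by fun_prop)]
  have e2 : ∫ p, ‖p.2‖ ^ 2 ∂γ = ∫ y, ‖y‖ ^ 2 ∂μ := by
    rw [← h.2, integral_map (by fun_prop) (by fun_prop)]
  have e3 : ∫ p, ⟪m, p.1⟫ ∂γ = 0 := by
    rw [integral_inner j1]
    have : ∫ p, p.1 ∂γ = 0 := by
      rw [← integral_id_stdGaussian, ← h.1, integral_map (by fun_prop) (by fun_prop)]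
    simp [this]
  have e4 : ∫ p, ⟪m, p.2⟫ ∂γ = ⟪m, ∫ y, y ∂μ⟫ := by
    rw [integral_inner j2]
    congr 1
    rw [← h.2, integral_map (by fun_prop) (by fun_prop)]
  rw [integral_map (by fun_prop) (by fun_prop)]
  have hexp (p : EuclideanSpace ℝ (Fin d) × EuclideanSpace ℝ (Fin d)) :
      ‖m + s • p.1 - p.2‖ ^ 2 = ‖m‖ ^ 2 + 2 * s * ⟪m, p.1⟫ + s ^ 2 * ‖p.1‖ ^ 2 + ‖p.2‖ ^ 2
        - 2 * ⟪m, p.2⟫ - s * (‖p.1‖ ^ 2 + ‖p.2‖ ^ 2 - ‖p.1 - p.2‖ ^ 2) := by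
    rw [norm_sub_sq_real, norm_add_sq_real, norm_sub_sq_real p.1, inner_add_left,
      real_inner_smul_right, real_inner_smul_left, norm_smul, mul_pow, Real.norm_eq_abs, sq_abs]
    ring
  simp_rw [hexp]
  rw [integral_sub (by fun_prop) (by fun_prop), integral_sub (by fun_prop) (by fun_prop),
    integral_add (by fun_prop) (by fun_prop), integral_add (by fun_prop) (by fun_prop),
    integral_add (by fun_prop) (by fun_prop), integral_const_mul, integral_const_mul,
    integral_const_mul, integral_const_mul, integral_sub (by fun_prop) (by fun_prop),
    integral_add (by fun_prop) (by fun_prop), e1, e2, e3, e4]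
  simp
  ring

/-- Apart from the terms `‖m‖²` and `d s²`, the squared distance from `N(m, s² I)` to a fixed
measure is affine in `(m, s)`: the coupling problem is the one for `N(0, I)`, rescaled by `s`. -/
lemma toReal_wassersteinSq_isotropicGaussian (hμ : IsP2 μ) (m : EuclideanSpace ℝ (Fin d)) {s : ℝ}
    (hs : 0 ≤ s) :
    (wassersteinSq (isotropicGaussian m s) μ).toReal =
      ‖m‖ ^ 2 + d * s ^ 2 + ∫ y, ‖y‖ ^ 2 ∂μ - 2 * ⟪m, ∫ y, y ∂μ⟫
        - s * (d + ∫ y, ‖y‖ ^ 2 ∂μ - (wassersteinSq (stdGaussian _) μ).toReal) := by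
  have := hμ.1
  have hstd := isGLB_couplingCosts (ρ := stdGaussian (EuclideanSpace ℝ (Fin d)))
    IsP2.of_isGaussian hμ
  refine (isGLB_couplingCosts IsP2.of_isGaussian hμ).unique ⟨?_, fun b hb ↦ ?_⟩
  · rintro _ ⟨γ, hγ, rfl⟩
    obtain ⟨γ', hγ', rfl⟩ := hγ.exists_map_stdGaussian hs
    rw [hγ'.integral_map_stdGaussian hμ m s]
    gcongr
    exact hstd.1 ⟨γ', hγ', rfl⟩
  · have hb' (c : ℝ) (hc : c ∈ couplingCosts (stdGaussian _) μ) :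
        b ≤ ‖m‖ ^ 2 + d * s ^ 2 + ∫ y, ‖y‖ ^ 2 ∂μ - 2 * ⟪m, ∫ y, y ∂μ⟫
          - s * (d + ∫ y, ‖y‖ ^ 2 ∂μ - c) := by
      obtain ⟨γ, hγ, rfl⟩ := hc
      rw [← hγ.integral_map_stdGaussian hμ m s]
      exact hb ⟨_, hγ.map_stdGaussian m hs, rfl⟩
    rcases hs.eq_or_lt with rfl | hs'
    · obtain ⟨c, hc⟩ := couplingCosts_nonempty (ρ := stdGaussian (EuclideanSpace ℝ (Fin d)))
        IsP2.of_isGaussian hμ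
      simpa using hb' c hc
    · have hlb : (b - (‖m‖ ^ 2 + d * s ^ 2 + ∫ y, ‖y‖ ^ 2 ∂μ - 2 * ⟪m, ∫ y, y ∂μ⟫
          - s * (d + ∫ y, ‖y‖ ^ 2 ∂μ))) / s ∈ lowerBounds (couplingCosts (stdGaussian _) μ) := by
        intro c hc
        rw [div_le_iff₀ hs']
        linarith [hb' c hc]
      have hle := hstd.2 hlb
      rw [div_le_iff₀ hs'] at hle
      linarith

end GaussianTransport

/-! ### Averaging over the mixture -/

section Mixture

variable {Z : Type*} [MeasurableSpace Z] {d : ℕ} {ν : Measure Z}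
  {κ : Kernel Z (EuclideanSpace ℝ (Fin d))}
  {xbar : Z → EuclideanSpace ℝ (Fin d)} {σ : Z → ℝ}

lemma MeasureTheory.Measure.integrable_integral_of_integrable_bind {X F : Type*}
    [MeasurableSpace X] [NormedAddCommGroup F] [NormedSpace ℝ F] {κ : Kernel Z X} {f : X → F}
    (hf : Integrable f (ν.bind κ)) : Integrable (fun z ↦ ∫ x, f x ∂κ z) ν := by
  rw [Measure.comp_eq_comp_const_apply] at hf
  simpa using hf.integral_comp

lemma MeasureTheory.Measure.integral_bind_kernel {X F : Type*}
    [MeasurableSpace X] [NormedAddCommGroup F] [NormedSpace ℝ F] {κ : Kernel Z X} {f : X → F}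
    (hf : Integrable f (ν.bind κ)) : ∫ x, f x ∂(ν.bind κ) = ∫ z, ∫ x, f x ∂κ z ∂ν := by
  rw [Measure.comp_eq_comp_const_apply] at hf ⊢
  simpa using Kernel.integral_comp hf

lemma ae_eq_mean (hκ : ∀ᵐ z ∂ν, κ z = isotropicGaussian (xbar z) (σ z)) :
    (fun z ↦ ∫ x, x ∂κ z) =ᵐ[ν] xbar := by
  filter_upwards [hκ] with z hz
  rw [hz, integral_isotropicGaussian]

/-- The parameters are not assumed measurable: `xbar` is recovered as the mean of `κ`, and `σ` as
the square root of the normalised trace of its covariance, which is where `0 < d` enters. -/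
lemma memLp_parameters (hd : 0 < d) (hρ : IsP2 (ν.bind κ)) (hσ : ∀ᵐ z ∂ν, 0 ≤ σ z)
    (hκ : ∀ᵐ z ∂ν, κ z = isotropicGaussian (xbar z) (σ z)) :
    MemLp xbar 2 ν ∧ MemLp σ 2 ν := by
  have := hρ.1
  have hd' : (0 : ℝ) < d := by exact_mod_cast hd
  have hx : AEStronglyMeasurable xbar ν :=
    ((Measure.integrable_integral_of_integrable_bind
      (hρ.memLp.integrable (by norm_num))).congr (ae_eq_mean hκ)).1
  have hsum : Integrable (fun z ↦ ‖xbar z‖ ^ 2 + d * σ z ^ 2) ν := by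
    refine (Measure.integrable_integral_of_integrable_bind
      (hρ.memLp.integrable_norm_pow (by norm_num))).congr ?_
    filter_upwards [hσ, hκ] with z hz hz'
    rw [hz', integral_norm_sq_isotropicGaussian _ hz]
  have hx2 : Integrable (fun z ↦ ‖xbar z‖ ^ 2) ν := by
    refine hsum.mono' (by fun_prop) (ae_of_all _ fun z ↦ ?_)
    rw [Real.norm_of_nonneg (by positivity)]
    exact le_add_of_nonneg_right (by positivity)
  have hσ2 : Integrable (fun z ↦ σ z ^ 2) ν := by
    refine ((hsum.sub hx2).div_const (d : ℝ)).congr (ae_of_all _ fun z ↦ ?_)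
    simp [hd'.ne']
  have hσm : AEStronglyMeasurable σ ν := by
    refine (Real.continuous_sqrt.comp_aestronglyMeasurable hσ2.1).congr ?_
    filter_upwards [hσ] with z hz using Real.sqrt_sq hz
  exact ⟨(memLp_two_iff_integrable_sq_norm hx).2 hx2, (memLp_two_iff_integrable_sq hσm).2 hσ2⟩

/-- The cost of `μ` exceeds its squared distance to the claimed barycenter by a constant. -/
lemma exists_transportCost_eq_add [IsProbabilityMeasure ν] (hx : MemLp xbar 2 ν)
    (hσ2 : MemLp σ 2 ν) (hσ : ∀ᵐ z ∂ν, 0 ≤ σ z)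
    (hκ : ∀ᵐ z ∂ν, κ z = isotropicGaussian (xbar z) (σ z)) :
    ∃ V : ℝ≥0∞, V ≠ ∞ ∧ ∀ μ : Measure (EuclideanSpace ℝ (Fin d)), IsP2 μ →
      transportCost ν κ μ =
        V + wassersteinSq (isotropicGaussian (∫ z, xbar z ∂ν) (∫ z, σ z ∂ν)) μ := by
  set m := ∫ z, xbar z ∂ν
  set s := ∫ z, σ z ∂ν with hs
  have hs0 : 0 ≤ s := integral_nonneg_of_ae hσ
  have ix : Integrable xbar ν := hx.integrable (by norm_num)
  have iσ : Integrable σ ν := hσ2.integrable (by norm_num)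
  have ix2 : Integrable (fun z ↦ ‖xbar z‖ ^ 2) ν := hx.integrable_norm_pow (by norm_num)
  have iσ2 : Integrable (fun z ↦ σ z ^ 2) ν := hσ2.integrable_sq
  set V : ℝ := ∫ z, ‖xbar z‖ ^ 2 ∂ν + d * ∫ z, σ z ^ 2 ∂ν - ‖m‖ ^ 2 - d * s ^ 2
  have key (μ : Measure (EuclideanSpace ℝ (Fin d))) (hμ : IsP2 μ) :
      Integrable (fun z ↦ (wassersteinSq (κ z) μ).toReal) ν ∧
      ∫ z, (wassersteinSq (κ z) μ).toReal ∂ν =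
        V + (wassersteinSq (isotropicGaussian m s) μ).toReal := by
    have hae : (fun z ↦ ‖xbar z‖ ^ 2 + d * σ z ^ 2 + ∫ y, ‖y‖ ^ 2 ∂μ - 2 * ⟪xbar z, ∫ y, y ∂μ⟫
        - σ z * (d + ∫ y, ‖y‖ ^ 2 ∂μ - (wassersteinSq (stdGaussian _) μ).toReal)) =ᵐ[ν]
        fun z ↦ (wassersteinSq (κ z) μ).toReal := by
      filter_upwards [hσ, hκ] with z hz hz'
      rw [hz', toReal_wassersteinSq_isotropicGaussian hμ _ hz]
    have iin : Integrable (fun z ↦ ⟪xbar z, ∫ y, y ∂μ⟫) ν := ix.inner_const _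
    have ein : ∫ z, ⟪xbar z, ∫ y, y ∂μ⟫ ∂ν = ⟪m, ∫ y, y ∂μ⟫ := by
      simp_rw [real_inner_comm (∫ y, y ∂μ)]
      rw [integral_inner ix]
    refine ⟨Integrable.congr (by fun_prop) hae, ?_⟩
    rw [← integral_congr_ae hae, toReal_wassersteinSq_isotropicGaussian hμ _ hs0,
      integral_sub (by fun_prop) (by fun_prop), integral_sub (by fun_prop) (by fun_prop),
      integral_add (by fun_prop) (by fun_prop), integral_add (by fun_prop) (by fun_prop),
      integral_const_mul, integral_const_mul, integral_mul_const, ein, ← hs]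
    simp
    ring
  -- `V` is itself the cost of the claimed barycenter, hence nonnegative.
  have hV0 : 0 ≤ V := by
    have h := (key (isotropicGaussian m s) IsP2.of_isGaussian).2
    rw [wassersteinSq_self, ENNReal.toReal_zero, add_zero] at h
    rw [← h]
    exact integral_nonneg fun _ ↦ ENNReal.toReal_nonneg
  refine ⟨ENNReal.ofReal V, ENNReal.ofReal_ne_top, fun μ hμ ↦ ?_⟩
  rw [← ENNReal.ofReal_toReal (wassersteinSq_lt_top (ρ := isotropicGaussian m s)
    IsP2.of_isGaussian hμ).ne, ← ENNReal.ofReal_add hV0 ENNReal.toReal_nonneg, ← (key μ hμ).2,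
    ofReal_integral_eq_lintegral_ofReal (key μ hμ).1 (ae_of_all _ fun _ ↦ ENNReal.toReal_nonneg)]
  refine lintegral_congr_ae ?_
  filter_upwards [hκ] with z hz
  rw [hz, ENNReal.ofReal_toReal (wassersteinSq_lt_top IsP2.of_isGaussian hμ).ne]

end Mixture

theorem mainTheorem3 {Z : Type*} [MeasurableSpace Z] {d : ℕ} (hd : 0 < d)
    (ν : Measure Z) [IsProbabilityMeasure ν]
    (κ : Kernel Z (EuclideanSpace ℝ (Fin d))) [IsMarkovKernel κ]
    (hρ : IsP2 (ν.bind κ))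
    (xbar : Z → EuclideanSpace ℝ (Fin d)) (σ : Z → ℝ)
    (hσ : ∀ᵐ z ∂ν, 0 ≤ σ z)
    (hκ : ∀ᵐ z ∂ν, κ z = isotropicGaussian (xbar z) (σ z)) :
    Integrable xbar ν ∧ Integrable σ ν ∧
      ∫ z, xbar z ∂ν = ∫ x, x ∂(ν.bind κ) ∧
      IsBarycenter ν κ (isotropicGaussian (∫ z, xbar z ∂ν) (∫ z, σ z ∂ν)) ∧
      ∀ μ : Measure (EuclideanSpace ℝ (Fin d)), IsBarycenter ν κ μ →
        μ = isotropicGaussian (∫ z, xbar z ∂ν) (∫ z, σ z ∂ν) := by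
  have := hρ.1
  obtain ⟨hx, hσ2⟩ := memLp_parameters hd hρ hσ hκ
  obtain ⟨V, hV, hcost⟩ := exists_transportCost_eq_add hx hσ2 hσ hκ
  have hP2 : IsP2 (isotropicGaussian (∫ z, xbar z ∂ν) (∫ z, σ z ∂ν)) := IsP2.of_isGaussian
  have hself := hcost _ hP2
  rw [wassersteinSq_self, add_zero] at hself
  refine ⟨hx.integrable (by norm_num), hσ2.integrable (by norm_num), ?_, ⟨hP2, fun μ hμ ↦ ?_⟩,
    fun μ hμ ↦ ?_⟩
  · rw [Measure.integral_bind_kernel (hρ.memLp.integrable (by norm_num)),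
      integral_congr_ae (ae_eq_mean hκ)]
  · rw [hself, hcost μ hμ]
    exact le_self_add
  · have hle := hμ.2 _ hP2
    rw [hself, hcost μ hμ.1] at hle
    refine (eq_of_wassersteinSq_eq_zero hP2 hμ.1 ?_).symm
    exact le_zero_iff.1 ((ENNReal.add_le_add_iff_left hV).1 (hle.trans_eq (add_zero V).symm))
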